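/- **Model (semi-MPC).** Fix a constant $c$. A semi-MPC algorithm $\mathcal A$ for graphs with vertex set $\{0,\dots,n-1\}$, $n\ge 1$, uses machines with a space of $s\le cn$ words of $w\le c(\lfloor\log_2 n\rfloor+1)$ bits each; the number $p\le s$ of machines may depend on the number of edges. The edges of the input graph $G$ are initially distributed adversarially among the machines, each edge on exactly one machine, an edge taking two words, so that each machine's share fits into its space (such a distribution is required to exist). In every synchronous round each machine sends words to the other machines as a function of its memory, and then updates its memory from the words received; it may send at most $s$ words and receive at most $s$ words per round. Local computation is arbitrary. Machines may have private random tapes. $\mathcal A$ *runs for $T$ rounds on $G$* if these bounds hold in the first $T$ rounds for every initial distribution and all random tapes. **Model (congested clique).** Each of the $n$ vertices is a node that initially knows its incident edges (and its private tape, if any). In every synchronous round every ordered pair of nodes exchanges one message of $O(\log n)$ bits; local computation and memory are arbitrary. **Theorem 3.2.** For every constant $c$ there are constants $K$ and $b$, depending only on $c$, such that for every $n\ge 1$ and every semi-MPC algorithm $\mathcal A$ as above for $n$-vertex graphs there is a congested clique algorithm $\mathcal B$ on $n$ nodes, with messages of $b(\lfloor\log_2 n\rfloor+1)$ bits, that simulates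 $\mathcal A$ in the following sense. Machine $i$ is played by node $i \bmod n$ (so distinct machines are played by distinct nodes if $p\le n$), and the tape of a node consists of the random tapes of the machines it plays, and of nothing else. For every $n$-vertex graph $G$ whose edges can be distributed as above, there is an admissible initial distribution $D$ of the edges of $G$, independent of the random tapes, such that whenever $\mathcal A$ runs for $T\ge 1$ rounds on $G$, then for every outcome of the tapes and every machine $i$, the state of node $i\bmod n$ after $K\cdot T$ rounds of $\mathcal B$ on $G$ determines, by a function that depends only on $i$, $\mathcal A$ and $\mathcal B$ (not on $G$, $T$ or the tapes), the memory contents (hence the output) of machine $i$ after $T$ rounds of $\mathcal A$ on $G$ started from $D$. In particular, every algorithm that runs in $T$ rounds of semi-MPC can be simulated deterministically, that is, with no additional randomness and no error, in $O(T)$ rounds of the congested clique. -/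

import Mathlib

/-- A semi-MPC algorithm for graphs on the vertex set `Fin n`, with the constant `c` in its
`O(n)` space and `O(log n)` word size.  The number of machines may depend on the number `m` of
edges.  The memory of a machine consists of `s` words of `w` bits.  `R` is the type of the
private random tape of a machine (take `R = Unit` for a deterministic algorithm).  As usual,
local computation is free, so each local step is an arbitrary function. -/
structure SemiMPC (c n : ℕ) (R : Type) where
  /-- space per machine, in words -/
  s : ℕ
  /-- length of a word, in bits -/
  w : ℕ
  /-- number of machines, for inputs with `m` edges -/
  p : ℕ → ℕ
  s_le : s ≤ c * n
  w_le : w ≤ c * (Nat.log 2 n + 1)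
  /-- there are at most as many machines as words of space per machine -/
  p_le : ∀ m, p m ≤ s
  /-- `init m i ρ E`: the initial memory of machine `i`, from its tape `ρ` and its share `E` of
  the edges -/
  init : ∀ m, Fin (p m) → R → Set (Sym2 (Fin n)) → (Fin s → BitVec w)
  /-- `send m i ρ t x j`: the words that machine `i` sends to machine `j` in round `t` when its
  memory is `x` -/
  send : ∀ m, Fin (p m) → R → ℕ → (Fin s → BitVec w) → Fin (p m) → List (BitVec w)
  /-- `recv m i ρ t x inbox`: the memory of machine `i` after round `t`, when its memory was `x`
  and it received the words `inbox j` from each machine `j` -/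
  recv : ∀ m, Fin (p m) → R → ℕ → (Fin s → BitVec w) → (Fin (p m) → List (BitVec w)) →
    (Fin s → BitVec w)

namespace SemiMPC

variable {c n : ℕ} {R : Type} (A : SemiMPC c n R)

/-- The memories of the machines after `t` rounds, on inputs with `m` edges, when machine `i`
initially holds the edges `D i` and its random tape is `r i`. -/
def run (m : ℕ) (D : Fin (A.p m) → Set (Sym2 (Fin n))) (r : ℕ → R) :
    ℕ → Fin (A.p m) → (Fin A.s → BitVec A.w)
  | 0 => fun i => A.init m i (r i) (D i)
  | t + 1 => fun i =>
      A.recv m i (r i) t (run m D r t i) fun j => A.send m j (r j) t (run m D r t j) i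

/-- The number of words that machine `i` sends to machine `j` in round `t`
(rounds are numbered from `0`). -/
def traffic (m : ℕ) (D : Fin (A.p m) → Set (Sym2 (Fin n))) (r : ℕ → R) (t : ℕ)
    (i j : Fin (A.p m)) : ℕ :=
  (A.send m i (r i) t (A.run m D r t i) j).length

/-- `D` is an admissible initial distribution of the edges of `G`: every edge is held by exactly
one machine, and the share of each machine fits into its space (an edge takes two words). -/
structure IsDistribution (G : SimpleGraph (Fin n))
    (D : Fin (A.p G.edgeSet.ncard) → Set (Sym2 (Fin n))) : Prop where
  disjoint : Pairwise fun i j => Disjoint (D i) (D j)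
  union : ⋃ i, D i = G.edgeSet
  fits : ∀ i, 2 * (D i).ncard ≤ A.s

/-- `A` can be run for `T` rounds on input `G`: the machines have enough space for the edges of
`G`, and for every (adversarial) initial distribution of the edges and all random tapes, every
machine sends at most `s` words and receives at most `s` words in each of the first `T` rounds. -/
structure RunsFor (G : SimpleGraph (Fin n)) (T : ℕ) : Prop where
  fits : ∃ D, A.IsDistribution G D
  send_le : ∀ D, A.IsDistribution G D → ∀ r, ∀ t < T, ∀ i,
    ∑ j, A.traffic G.edgeSet.ncard D r t i j ≤ A.s
  recv_le : ∀ D, A.IsDistribution G D → ∀ r, ∀ t < T, ∀ j,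
    ∑ i, A.traffic G.edgeSet.ncard D r t i j ≤ A.s

end SemiMPC

/-- A congested clique algorithm for graphs on `Fin n` with messages of `b` bits: node `v`
initially knows the graph's neighbours of `v` and a private tape in `Ω v` and nothing else about
the input, and in every round each node sends one `b`-bit message to every node.  Local memory
and local computation are unrestricted. -/
structure CongestedClique (n b : ℕ) (Ω : Fin n → Type) where
  State : Type
  init : (v : Fin n) → Ω v → Set (Fin n) → State
  /-- `send v x u`: the message from `v` to `u` when `v` is in state `x` -/
  send : Fin n → State → Fin n → BitVec b
  /-- `recv v x inbox`: the new state of `v`, when it was `x` and `u` sent `inbox u` to `v` -/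
  recv : Fin n → State → (Fin n → BitVec b) → State

/-- The states of the nodes after `t` rounds on input `G` with tapes `ω`. -/
def CongestedClique.run {n b : ℕ} {Ω : Fin n → Type} (B : CongestedClique n b Ω)
    (G : SimpleGraph (Fin n)) (ω : ∀ v, Ω v) : ℕ → Fin n → B.State
  | 0 => fun v => B.init v (ω v) (G.neighborSet v)
  | t + 1 => fun v => B.recv v (run B G ω t v) fun u => B.send u (run B G ω t u) v

/-- The clique node that plays machine `i`, namely `i mod n`.  If there are at most `n` machines,
then different machines are played by different nodes. -/
def cliqueHost (n : ℕ) [NeZero n] (i : ℕ) : Fin n := Fin.ofNat n i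

/-- The tape of a clique node: the random tapes of the machines it plays, and nothing else. -/
abbrev CliqueTape (n : ℕ) [NeZero n] (R : Type) (v : Fin n) : Type :=
  {i : ℕ // cliqueHost n i = v} → R

/-- The clique algorithm `B` simulates the semi-MPC algorithm `A` with `K` rounds per round.
On each graph `G` there is one admissible initial distribution `D` of its edges, not depending on
the random tapes, such that whenever `A` can be run for `T ≥ 1` rounds on `G`, for every outcome
of the tapes the node playing machine `i` can read off from its own state after `K * T` rounds the
memory of machine `i` after `T` rounds of `A` started from `D`. -/
def Simulates {c n b : ℕ} [NeZero n] {R : Type} (K : ℕ)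
    (B : CongestedClique n b (CliqueTape n R)) (A : SemiMPC c n R) : Prop :=
  ∃ read : ℕ → B.State → (Fin A.s → BitVec A.w),
    ∀ G : SimpleGraph (Fin n), (∃ D, A.IsDistribution G D) →
      ∃ D, A.IsDistribution G D ∧
        ∀ T, 1 ≤ T → A.RunsFor G T → ∀ (r : ℕ → R) (i : Fin (A.p G.edgeSet.ncard)),
          read i (B.run G (fun _ j => r j.1) (K * T) (cliqueHost n i)) =
            A.run G.edgeSet.ncard D r T i

/-! The machines are played by the nodes of a virtual `g × g` grid with `g * g` between `(c + 1) *
n` and `4 * (c + 1) * n`, so each clique node hosts boundedly many grid nodes and bundles their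
messages into one message of `O(log n)` bits. A round of semi-MPC then asks for routing in which
every grid node is source and destination of at most `s ≤ g * g` words. It suffices to do this
deterministically in constantly many rounds.

Routing (`learn_route`) corrects one grid coordinate at a time. A row of `g` nodes shares its `g *
g` packet counts, one for each member and key, in two rounds (`learn_in_group`). From the counts
alone all members compute the same assignment of packets to relays, which balances both the packets
of each member and the packets of each key (`exists_group_assignment`). It comes from a greedy
colouring (`exists_balanced_coloring`): each of the two constraints rules out fewer than half of the
colours. With the destination row as key, the relays can spread the packets evenly over their
destination rows; with the destination column as key, the relays deliver them.

For the input, every edge is owned by its smaller endpoint. Once the numbers of owned edges are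
broadcast, owners can rank their edges globally, and the edges are routed to the machines in blocks
of `s / 2`. This initialization takes nine rounds and each simulated round eight. The distribution
depends on the graph only, and no step needs extra randomness. -/

/-- What the nodes `ι` know, as a function of the instance `a : I`. -/
structure View (I ι : Type) where
  Z : Type
  val : I → ι → Z

/-! ### Knowledge of the nodes and rounds with a bounded message alphabet -/

namespace View

variable {I ι : Type}

/-- On the instances in `S`, every node can compute its value of `f` from its view. -/
def Det (S : Set I) (V : View I ι) {Y : Type} (f : I → ι → Y) : Prop :=
  ∃ h : ι → V.Z → Y, ∀ a ∈ S, ∀ v, f a v = h v (V.val a v)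

/-- The view `V` together with the knowledge of `f`. -/
def adjoin (V : View I ι) {Y : Type} (f : I → ι → Y) : View I ι :=
  ⟨V.Z × Y, fun a v => (V.val a v, f a v)⟩

/-- One round of communication, with at most `B` different messages, leads from `V` to `W`. -/
def Round (B : ℕ) (S : Set I) (V W : View I ι) : Prop :=
  ∃ (M : Type) (_ : Fintype M) (_ : Nonempty M), Fintype.card M ≤ B ∧
    ∃ (send : ι → V.Z → ι → M) (recv : ι → V.Z → (ι → M) → W.Z),
      ∀ a ∈ S, ∀ v, W.val a v = recv v (V.val a v) fun u => send u (V.val a u) v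

/-- A number of rounds of communication lead from `V` to `W`. -/
def Reach (B : ℕ) (S : Set I) : ℕ → View I ι → View I ι → Prop
  | 0, V, W => V = W
  | k + 1, V, W => ∃ U, Reach B S k V U ∧ Round B S U W

/-- In `k` rounds the nodes learn `f`, without forgetting anything. -/
def Learn (B : ℕ) (S : Set I) (k : ℕ) (V : View I ι) {Y : Type} (f : I → ι → Y) : Prop :=
  Reach B S k V (V.adjoin f)

variable {B : ℕ} {S : Set I} {V W U : View I ι} {X Y Y' : Type}

theorem Det.comp {f : I → ι → Y} (hf : Det S V f) (h : ι → Y → Y') :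
    Det S V fun a v => h v (f a v) := by
  obtain ⟨p, hp⟩ := hf
  exact ⟨fun v z => h v (p v z), fun a ha v => congrArg (h v) (hp a ha v)⟩

theorem Det.comp₂ {f : I → ι → X} {f' : I → ι → Y} (hf : Det S V f) (hf' : Det S V f')
    (h : ι → X → Y → Y') : Det S V fun a v => h v (f a v) (f' a v) := by
  obtain ⟨p, hp⟩ := hf
  obtain ⟨q, hq⟩ := hf'
  exact ⟨fun v z => h v (p v z) (q v z), fun a ha v =>
    congrArg₂ (h v) (hp a ha v) (hq a ha v)⟩

theorem Det.val : Det S V V.val := ⟨fun _ z => z, fun _ _ _ => rfl⟩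

theorem Det.congr {f f' : I → ι → Y} (hf : Det S V f) (h : ∀ a ∈ S, ∀ v, f' a v = f a v) :
    Det S V f' := by
  obtain ⟨p, hp⟩ := hf
  exact ⟨p, fun a ha v => by rw [h a ha v, hp a ha v]⟩

theorem Det.adjoin {f : I → ι → Y} (hf : Det S V f) (f' : I → ι → Y') :
    Det S (V.adjoin f') f := by
  obtain ⟨p, hp⟩ := hf
  exact ⟨fun v z => p v z.1, hp⟩

theorem det_adjoin (f : I → ι → Y) : Det S (V.adjoin f) f :=
  ⟨fun _ z => z.2, fun _ _ _ => rfl⟩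

theorem Round.map (h : Round B S V U) (hd : Det S U W.val) : Round B S V W := by
  obtain ⟨M, i₁, i₂, hM, send, recv, hr⟩ := h
  obtain ⟨p, hp⟩ := hd
  exact ⟨M, i₁, i₂, hM, send, fun v z x => p v (recv v z x), fun a ha v => by
    rw [hp a ha v, hr a ha v]⟩

theorem Round.idle (hB : 1 ≤ B) : Round B S V V :=
  ⟨Unit, inferInstance, inferInstance, by simpa using hB, fun _ _ _ => (), fun _ z _ => z,
    fun _ _ _ => rfl⟩

/-- Local computation is free because it is absorbed by `recv` of the last round. Zero rounds mean
equality of views, hence the `k + 1`. -/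
theorem Reach.map {k : ℕ} (h : Reach B S (k + 1) V U) (hd : Det S U W.val) :
    Reach B S (k + 1) V W := by
  obtain ⟨Z, h₁, h₂⟩ := h
  exact ⟨Z, h₁, h₂.map hd⟩

theorem Reach.trans {k l : ℕ} (h : Reach B S k V U) (h' : Reach B S l U W) :
    Reach B S (k + l) V W := by
  induction l generalizing W with
  | zero => cases h'; exact h
  | succ l ih =>
    obtain ⟨Z, h₁, h₂⟩ := h'
    exact ⟨Z, ih h₁, h₂⟩

theorem Reach.idle (k : ℕ) (hB : 1 ≤ B) : Reach B S k V V := by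
  induction k with
  | zero => rfl
  | succ k ih => exact ⟨V, ih, Round.idle hB⟩

theorem Reach.exists_chain {k : ℕ} (h : Reach B S k V W) :
    ∃ c : ℕ → View I ι, c 0 = V ∧ c k = W ∧ ∀ j < k, Round B S (c j) (c (j + 1)) := by
  induction k generalizing W with
  | zero => exact ⟨fun _ => V, rfl, h, by simp⟩
  | succ k ih =>
    obtain ⟨U, h₁, h₂⟩ := h
    obtain ⟨c, hc₀, hck, hc⟩ := ih h₁
    refine ⟨fun j => if j ≤ k then c j else W, by simp [hc₀], by simp, fun j hj => ?_⟩
    rcases Nat.lt_succ_iff_lt_or_eq.1 hj with hj | rfl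
    · simpa [hj.le, Nat.succ_le_of_lt hj] using hc j hj
    · simpa [hck] using h₂

/-- A clique algorithm is a single sequence of rounds that does not know `T`, so the segments of
length `K` are glued: round `j` is step `j % K` of segment `j / K`. -/
theorem exists_infinite_chain {K : ℕ} (hK : 0 < K) {S : ℕ → Set I} {V : ℕ → View I ι}
    (h : ∀ t, Reach B (S t) K (V t) (V (t + 1))) :
    ∃ c : ℕ → View I ι, (∀ t, c (K * t) = V t) ∧
      ∀ j, Round B (S (j / K)) (c j) (c (j + 1)) := by
  choose c hc₀ hcK hc using fun t => (h t).exists_chain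
  refine ⟨fun j => c (j / K) (j % K), fun t => ?_, fun j => ?_⟩
  · simp [Nat.mul_div_cancel_left _ hK, hc₀]
  · have hj := Nat.mod_lt j hK
    have hr := hc (j / K) _ hj
    have hd : j + 1 = K * (j / K) + (j % K + 1) := by rw [← add_assoc, Nat.div_add_mod]
    rcases Nat.lt_or_ge (j % K + 1) K with hlt | hge
    · have h₁ : (j + 1) / K = j / K := by
        rw [hd, Nat.mul_add_div hK, Nat.div_eq_of_lt hlt, add_zero]
      have h₂ : (j + 1) % K = j % K + 1 := by
        rw [hd, Nat.mul_add_mod, Nat.mod_eq_of_lt hlt]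
      simpa only [h₁, h₂] using hr
    · have h₀ : j % K + 1 = K := by omega
      have h₁ : (j + 1) / K = j / K + 1 := by
        rw [hd, h₀, Nat.mul_add_div hK, Nat.div_self hK]
      have h₂ : (j + 1) % K = 0 := by
        rw [hd, h₀, Nat.mul_add_mod, Nat.mod_self]
      simp only [h₁, h₂, hc₀]
      rwa [h₀, hcK] at hr

theorem Learn.of_det {k : ℕ} {f : I → ι → Y} {f' : I → ι → Y'} (h : Learn B S (k + 1) V f)
    (hd : Det S (V.adjoin f) f') : Learn B S (k + 1) V f' :=
  Reach.map h ((Det.val.adjoin f).comp₂ hd fun _ z y => (z, y))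

theorem Learn.trans {k l : ℕ} {f : I → ι → Y} {f' : I → ι → Y'} (h : Learn B S k V f)
    (h' : Learn B S (l + 1) (V.adjoin f) f') : Learn B S (k + (l + 1)) V f' :=
  Reach.trans h (Reach.map h' (((Det.val.adjoin f).adjoin f').comp₂ (det_adjoin f')
    fun _ z y => (z, y)))

theorem learn_inbox {M : Type} [Fintype M] [Nonempty M] {msg : I → ι → ι → M}
    (hM : Fintype.card M ≤ B) (hd : Det S V msg) :
    Learn B S 1 V fun a v u => msg a u v := by
  obtain ⟨p, hp⟩ := hd
  exact ⟨V, rfl, M, inferInstance, inferInstance, hM, p, fun _ z x => (z, x), fun a ha v =>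
    Prod.ext rfl (funext fun u => congrFun (hp a ha u) v)⟩

/-- The `g * g` values of a row match the number of nodes of the grid. First, node `(b, k)` collects
the `k`-th value of the `b`-th member of every row; then it sends to each node the value that
belongs to the row of that node. -/
theorem learn_in_group {g : ℕ} {V : View I (Fin g × Fin g)} {M : Type} [Fintype M] [Nonempty M]
    {f : I → Fin g × Fin g → Fin g → M} (hM : Fintype.card M ≤ B) (hd : Det S V f) :
    Learn B S 2 V fun a v b k => f a (v.1, b) k := by
  have d₁ : Det S V fun a u (v : Fin g × Fin g) => f a u v.2 := 
    hd.comp fun _ y (v : Fin g × Fin g) => y v.2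
  have d₂ : Det S (V.adjoin fun a v (u : Fin g × Fin g) => f a u v.2)
      fun a u (v : Fin g × Fin g) => f a (v.1, u.1) u.2 :=
    (det_adjoin _).comp fun (u : Fin g × Fin g) (y : Fin g × Fin g → M) (v : Fin g × Fin g) =>
      y (v.1, u.1)
  exact (Learn.trans (learn_inbox hM d₁) (learn_inbox hM d₂)).of_det
    ((det_adjoin _).comp fun _ (y : Fin g × Fin g → M) b k => y (b, k))

end View

/-! ### Balanced colourings and the assignment of packets to relays -/

open Finset in
/-- Few colours are used at least `p` times in a class of size less than `p * |X| / 2`. -/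
theorem two_mul_card_overused_lt {E X : Type*} [Fintype X] [DecidableEq X] (s : Finset E)
    (col : E → X) {p : ℕ} (h : 2 * (#s + 1) ≤ p * Fintype.card X) :
    2 * #{x | p ≤ #{e ∈ s | col e = x}} < Fintype.card X := by
  have h₁ := card_nsmul_le_sum (univ.filter fun x => p ≤ #{e ∈ s | col e = x})
    (fun x => #{e ∈ s | col e = x}) p (by simp)
  have h₂ : ∑ x ∈ univ.filter (fun x => p ≤ #{e ∈ s | col e = x}), #{e ∈ s | col e = x} ≤ #s := by
    rw [card_eq_sum_card_fiberwise (f := col) (t := univ) (by simp)]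
    exact sum_le_sum_of_subset (filter_subset _ _)
  rw [smul_eq_mul] at h₁
  by_contra hc
  push Not at hc
  have := Nat.mul_le_mul_left p hc
  nlinarith

open Finset in
/-- A greedy colouring that spreads both the fibres of `f` and those of `h` over the colours. -/
theorem exists_balanced_coloring {E A A' X : Type*} [Fintype X] [Nonempty X] [DecidableEq E]
    [DecidableEq A] [DecidableEq A'] [DecidableEq X] (s : Finset E) (f : E → A) (h : E → A')
    (p : A → ℕ) (q : A' → ℕ) (hp : ∀ a, 2 * #{e ∈ s | f e = a} ≤ p a * Fintype.card X)
    (hq : ∀ a, 2 * #{e ∈ s | h e = a} ≤ q a * Fintype.card X) :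
    ∃ col : E → X, ∀ x, (∀ a, #{e ∈ s | f e = a ∧ col e = x} ≤ p a) ∧
      ∀ a, #{e ∈ s | h e = a ∧ col e = x} ≤ q a := by
  induction s using Finset.induction_on with
  | empty => exact ⟨fun _ => Classical.arbitrary X, by simp⟩
  | insert e s he ih =>
    have mono (P : E → Prop) [DecidablePred P] : 2 * #{e ∈ s | P e} ≤ 2 * #{e ∈ insert e s | P e} :=
      Nat.mul_le_mul_left 2 (card_le_card (filter_subset_filter _ (subset_insert _ _)))
    obtain ⟨col, hcol⟩ := ih (fun a => (mono _).trans (hp a))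
      (fun a => (mono _).trans (hq a))
    have h₁ := two_mul_card_overused_lt {e' ∈ s | f e' = f e} col (p := p (f e)) (by
      have := hp (f e)
      rwa [filter_insert, if_pos rfl, card_insert_of_notMem (by simp [he])] at this)
    have h₂ := two_mul_card_overused_lt {e' ∈ s | h e' = h e} col (p := q (h e)) (by
      have := hq (h e)
      rwa [filter_insert, if_pos rfl, card_insert_of_notMem (by simp [he])] at this)
    -- The full colours for the `f`-fibre of `e` and those for its `h`-fibre each make up less than
    -- half of all colours, so one colour is left for `e`.
    obtain ⟨x, hx⟩ : ∃ x, x ∉ (univ.filter fun x => p (f e) ≤ #{e' ∈ {e' ∈ s | f e' = f e} | col e' = x}) ∪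
        univ.filter fun x => q (h e) ≤ #{e' ∈ {e' ∈ s | h e' = h e} | col e' = x} := by
      by_contra! hall
      have := card_union_le (univ.filter fun x => p (f e) ≤ #{e' ∈ {e' ∈ s | f e' = f e} | col e' = x})
        (univ.filter fun x => q (h e) ≤ #{e' ∈ {e' ∈ s | h e' = h e} | col e' = x})
      rw [eq_univ_iff_forall.2 hall, card_univ] at this
      omega
    simp only [mem_union, mem_filter, mem_univ, true_and, not_or, not_le, filter_filter] at hx
    have old {P : E → Prop} [DecidablePred P] (y : X) :
        {e' ∈ s | P e' ∧ Function.update col e x e' = y} = {e' ∈ s | P e' ∧ col e' = y} :=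
      filter_congr fun e' he' => by
        rw [Function.update_of_ne (ne_of_mem_of_not_mem he' he)]
    refine ⟨Function.update col e x, fun y => ⟨fun a => ?_, fun a => ?_⟩⟩
    · rw [filter_insert, old]
      split_ifs with hc
      · obtain ⟨rfl, hy⟩ := hc
        rw [Function.update_self] at hy
        subst hy
        exact (card_insert_le _ _).trans hx.1
      · exact (hcol y).1 a
    · rw [filter_insert, old]
      split_ifs with hc
      · obtain ⟨rfl, hy⟩ := hc
        rw [Function.update_self] at hy
        subst hy
        exact (card_insert_le _ _).trans hx.2
      · exact (hcol y).2 a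

/-- Ranks replace packets by numbers, so that an assignment of packets can be computed from their
counts alone. They also number the edges owned by a node. -/
theorem Finset.exists_bijOn_Iio_card {P : Type*} (F : Finset P) :
    ∃ rk : P → ℕ, Set.BijOn rk F (Set.Iio F.card) := by
  classical
  refine ⟨fun q => if h : q ∈ F then F.equivFin ⟨q, h⟩ else 0, fun q hq => ?_, fun q hq q' hq' he => ?_,
    fun j hj => ?_⟩
  · rw [Finset.mem_coe] at hq
    simp [hq]
  · rw [Finset.mem_coe] at hq hq'
    simp only [hq, hq', dite_true] at he
    simpa using F.equivFin.injective (Fin.ext he)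
  · refine ⟨F.equivFin.symm ⟨j, hj⟩, by simp, by simp⟩

/-- Sets with at most `k` elements are encoded by `k`-tuples. -/
theorem exists_encoding_finset (P : Type) (k : ℕ) :
    ∃ (enc : Finset P → Fin k → Option P) (dec : (Fin k → Option P) → Finset P),
      ∀ F, F.card ≤ k → dec (enc F) = F := by
  classical
  have h (F : Finset P) : ∃ e : Fin k → Option P, F.card ≤ k → ∀ q, q ∈ F ↔ ∃ i, e i = some q := by
    refine ⟨fun i => if h : i.1 < F.card then some (F.equivFin.symm ⟨i, h⟩).1 else none,
      fun hF q => ⟨fun hq => ⟨⟨F.equivFin ⟨q, hq⟩, by omega⟩, by simp⟩, fun ⟨i, hi⟩ => ?_⟩⟩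
    dsimp only at hi
    split_ifs at hi with h
    rw [← Option.some.inj hi]
    exact Subtype.coe_prop _
  choose enc henc using h
  refine ⟨enc, fun e => (Finset.univ.image e).eraseNone, fun F hF => ?_⟩
  ext q
  simp [henc F hF q]

open Finset in
/-- Given the number `n y k` of packets with key `k` at the member `y` of a group, the packets can
be assigned to intermediate nodes such that both the packets of every member and the packets of
every key are spread evenly. -/
theorem exists_group_assignment (g C : ℕ) [NeZero g] (n : Fin g → Fin g → ℕ) :
    ∃ γ : Fin g × Fin g × ℕ → Fin g × Fin g, ∀ {P : Type} [DecidableEq P] (key : P → Fin g)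
      (F : Fin g → Finset P) (rk : Finset P → P → ℕ),
      (∀ G : Finset P, Set.BijOn (rk G) G (Set.Iio #G)) → (∀ y, #(F y) ≤ C * (g * g)) →
      (∀ y k, #{q ∈ F y | key q = k} = n y k) → ∀ x,
      (∀ y, #{q ∈ F y | γ (y, key q, rk {q' ∈ F y | key q' = key q} q) = x} ≤ 2 * C) ∧
      ∀ k, ∑ y, #{q ∈ F y | γ (y, key q, rk {q' ∈ F y | key q' = key q} q) = x ∧ key q = k} ≤
        2 * ((∑ y, n y k) / (g * g) + 1) := by
  have hg : 0 < g * g := Nat.mul_pos (NeZero.pos g) (NeZero.pos g)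
  by_cases hn : ∀ y, ∑ k, n y k ≤ C * (g * g)
  swap
  · refine ⟨fun _ => 0, fun {P} _ key F rk _ hF hc => (hn fun y => ?_).elim⟩
    simp only [← hc]
    rw [← card_eq_sum_card_fiberwise (by simp)]
    exact hF y
  -- Placeholders for the packets: member, key, and rank among the packets of this member with this
  -- key. Actual packets inject into them, so bounds for a colouring of `s` carry over.
  let s : Finset (Fin g × Fin g × ℕ) :=
    univ.biUnion fun y => univ.biUnion fun k => (range (n y k)).image fun j => (y, k, j)
  have hs (y k j) : (y, k, j) ∈ s ↔ j < n y k := by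
    simp [s]
  have h₁ (y) : #{e ∈ s | e.1 = y} ≤ ∑ k, n y k := by
    calc
      _ ≤ #(univ.biUnion fun k => (range (n y k)).image fun j => (y, k, j)) := card_le_card <| by
        rintro ⟨y', k, j⟩ h
        rw [mem_filter, hs] at h
        obtain ⟨h, rfl⟩ := h
        simpa using h
      _ ≤ _ := card_biUnion_le.trans (sum_le_sum fun k _ => by
        simpa using card_image_le (s := range (n y k)) (f := fun j => (y, k, j)))
  have h₂ (k) : #{e ∈ s | e.2.1 = k} ≤ ∑ y, n y k := by
    calc
      _ ≤ #(univ.biUnion fun y => (range (n y k)).image fun j => (y, k, j)) := card_le_card <| by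
        rintro ⟨y, k', j⟩ h
        rw [mem_filter, hs] at h
        obtain ⟨h, rfl⟩ := h
        simpa using h
      _ ≤ _ := card_biUnion_le.trans (sum_le_sum fun y _ => by
        simpa using card_image_le (s := range (n y k)) (f := fun j => (y, k, j)))
  obtain ⟨γ, hγ⟩ := exists_balanced_coloring (X := Fin g × Fin g) s (fun e => e.1)
    (fun e => e.2.1) (fun _ => 2 * C) (fun k => 2 * ((∑ y, n y k) / (g * g) + 1))
    (fun y => by
      have := (h₁ y).trans (hn y)
      simp only [Fintype.card_prod, Fintype.card_fin]
      linarith)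
    (fun k => by
      have := Nat.lt_mul_div_succ (∑ y, n y k) hg
      have := h₂ k
      simp only [Fintype.card_prod, Fintype.card_fin]
      linarith)
  refine ⟨γ, fun {P} _ key F rk hrk hF hc x => ⟨fun y => ?_, fun k => ?_⟩⟩
  · refine (card_le_card_of_injOn (fun q => (y, key q, rk {q' ∈ F y | key q' = key q} q)) ?_ ?_).trans
      ((hγ x).1 y)
    · intro q hq
      simp only [coe_filter, Set.mem_ofPred_eq, hs] at hq ⊢
      refine ⟨?_, trivial, hq.2⟩
      rw [← hc]
      exact (hrk _).mapsTo (by simp [hq.1])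
    · intro q hq q' hq' he
      simp only [coe_filter, Set.mem_ofPred_eq] at hq hq'
      simp only [Prod.mk.injEq, true_and] at he
      obtain ⟨hk, he⟩ := he
      rw [hk] at he
      exact (hrk {q'' ∈ F y | key q'' = key q'}).injOn (by simp [hq.1, hk]) (by simp [hq'.1]) he
  · rw [← card_sigma]
    refine (card_le_card_of_injOn
      (fun p => (p.1, key p.2, rk {q' ∈ F p.1 | key q' = key p.2} p.2)) ?_ ?_).trans ((hγ x).2 k)
    · rintro ⟨y, q⟩ hq
      simp only [coe_sigma, Set.mem_sigma_iff, coe_univ, Set.mem_univ, true_and, coe_filter,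
        Set.mem_ofPred_eq, hs] at hq ⊢
      refine ⟨?_, hq.2.2, hq.2.1⟩
      rw [← hc]
      exact (hrk _).mapsTo (by simp [hq.1])
    · rintro ⟨y, q⟩ hq ⟨y', q'⟩ hq' he
      simp only [coe_sigma, Set.mem_sigma_iff, coe_univ, Set.mem_univ, true_and, coe_filter,
        Set.mem_ofPred_eq] at hq hq'
      simp only [Prod.mk.injEq] at he
      obtain ⟨rfl, hk, he⟩ := he
      rw [hk] at he
      rw [(hrk {q'' ∈ F y | key q'' = key q'}).injOn (by simp [hq.1, hk]) (by simp [hq'.1]) he]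

/-! ### Deterministic routing on the grid -/

namespace View

/-- Nodes can exchange sets of at most `k` packets in one round. -/
theorem learn_finset {I ι P : Type} [Fintype P] {k B : ℕ} {S : Set I} {V : View I ι}
    {F : I → ι → ι → Finset P} (hd : Det S V F) (hF : ∀ a ∈ S, ∀ u v, (F a u v).card ≤ k)
    (hB : (Fintype.card P + 1) ^ k ≤ B) : Learn B S 1 V fun a v u => F a u v := by
  obtain ⟨enc, dec, hdec⟩ := exists_encoding_finset P k
  have hd' : Det S V fun a u v => enc (F a u v) := hd.comp fun _ (f : ι → Finset P) v => enc (f v)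
  exact (learn_inbox (by classical simpa using hB) hd').of_det
    (((det_adjoin _).comp fun _ (y : ι → Fin k → Option P) u => dec (y u)).congr fun a ha v =>
      funext fun u => (hdec _ (hF a ha u v)).symm)

open Finset in
/-- The nodes send their packets to intermediate nodes, such that the packets with a given key from
a given group are spread evenly over the intermediate nodes. -/
theorem exists_learn_relay {I P : Type} [Fintype P] [DecidableEq P] {g C B : ℕ} [NeZero g]
    {S : Set I} {V : View I (Fin g × Fin g)} {H : I → Fin g × Fin g → Finset P} (key : P → Fin g)
    (hd : Det S V H) (hH : ∀ a ∈ S, ∀ i, #(H a i) ≤ C * (g * g)) (hB : C * (g * g) + 1 ≤ B)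
    (hB' : (Fintype.card P + 1) ^ (2 * C) ≤ B) :
    ∃ col : I → Fin g × Fin g → P → Fin g × Fin g,
      Learn B S 3 V (fun a x i => {q ∈ H a i | col a i q = x}) ∧
      ∀ a ∈ S, ∀ z k x, ∑ y, #{q ∈ H a (z, y) | col a (z, y) q = x ∧ key q = k} ≤
        2 * ((∑ y, #{q ∈ H a (z, y) | key q = k}) / (g * g) + 1) := by
  choose rk hrk using Finset.exists_bijOn_Iio_card (P := P)
  choose γ hγ using exists_group_assignment g C
  let cnt : I → Fin g → Fin g → Fin g → ℕ := fun a z y k => #{q ∈ H a (z, y) | key q = k}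
  -- The counts are sent as elements of a finite alphabet; on `S` the reduction modulo `C * (g * g)
  -- + 1` loses nothing.
  let cnt' : I → Fin g × Fin g → Fin g → Fin (C * (g * g) + 1) := fun a i k =>
    Fin.ofNat _ (cnt a i.1 i.2 k)
  have hcnt (a) (ha : a ∈ S) (i k) : (cnt' a i k : ℕ) = cnt a i.1 i.2 k := by
    refine Nat.mod_eq_of_lt (Nat.lt_succ_of_le ((card_filter_le _ _).trans (hH a ha i)))
  let part (n : Fin g → Fin g → ℕ) (F : Finset P) (i x : Fin g × Fin g) : Finset P :=
    {q ∈ F | γ n (i.2, key q, rk {q' ∈ F | key q' = key q} q) = x}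
  have hd₀ := hd.comp fun _ F (k : Fin g) => Fin.ofNat (C * (g * g) + 1) #{q ∈ F | key q = k}
  have hl₁ : Learn B S 2 V fun a i y k => cnt' a (i.1, y) k := learn_in_group (f := cnt') (by simpa using hB) hd₀
  have hd₁ : Det S (V.adjoin fun a i y k => cnt' a (i.1, y) k)
      fun a i x => part (cnt a i.1) (H a i) i x :=
    ((det_adjoin _).comp₂ (hd.adjoin _) fun i
      (n : Fin g → Fin g → Fin (C * (g * g) + 1)) F x =>
        part (fun y k => n y k) F i x).congr fun a ha i => by
      simp only [hcnt a ha]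
  have key_props (a) (ha : a ∈ S) (z) := hγ (cnt a z) key (fun y => H a (z, y)) rk hrk
    (fun y => hH a ha _) fun y k => rfl
  exact ⟨fun a i q => γ (cnt a i.1) (i.2, key q, rk {q' ∈ H a i | key q' = key q} q),
    hl₁.trans (learn_finset hd₁ (fun a ha i x => (key_props a ha i.1 x).1 i.2) hB'),
    fun a ha z k x => (key_props a ha z x).2 k⟩

end View

namespace View

theorem Learn.received {I ι α : Type} {B k : ℕ} {S : Set I} {V : View I ι}
    {G : I → ι → ι → Finset (ι × α)} (h : Learn B S (k + 1) V fun a u x => G a x u) :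
    Learn B S (k + 1) V fun a u => {z : α | ∃ x, (u, z) ∈ G a x u} := by
  have hd := (det_adjoin (S := S) (V := V) fun a u x => G a x u).comp
    fun u y => {z : α | ∃ x, (u, z) ∈ y x}
  exact h.of_det hd

open Finset in
/-- Deterministic routing: if every node is the source and the destination of at most as many
packets as there are nodes, then all packets can be delivered in eight rounds. -/
theorem learn_route {I α : Type} [Fintype α] [DecidableEq α] {g B : ℕ} [NeZero g]
    {S : Set I} {V : View I (Fin g × Fin g)}
    {H : I → Fin g × Fin g → Finset ((Fin g × Fin g) × α)} (hd : Det S V H)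
    (hout : ∀ a ∈ S, ∀ i, #(H a i) ≤ g * g)
    (hin : ∀ a ∈ S, ∀ u, ∑ i, #{q ∈ H a i | q.1 = u} ≤ g * g) (hB : 8 * (g * g) + 1 ≤ B)
    (hB' : (Fintype.card ((Fin g × Fin g) × α) + 1) ^ 16 ≤ B) :
    Learn B S 8 V fun a u => {x : α | ∃ i, (u, x) ∈ H a i} := by
  have hg : 0 < g := NeZero.pos g
  have hgg : 0 < g * g := Nat.mul_pos hg hg
  -- First phase: the key is the row of the destination.
  obtain ⟨col, hl₁, hcol⟩ := exists_learn_relay (C := 1) (B := B) (fun q => q.1.1) hd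
    (by simpa using hout) (by omega) (le_trans (Nat.pow_le_pow_right (by omega) (by omega)) hB')
  let F (a : I) (x : Fin g × Fin g) (k : Fin g) : Finset ((Fin g × Fin g) × α) :=
    univ.biUnion fun i => {q ∈ {q ∈ H a i | col a i q = x} | q.1.1 = k}
  -- At most `g * (g * g)` packets go to row `k`. The quotients by `g * g` add up to at most `g`
  -- over the source rows, and rounding costs one for each of the `g` rows, which gives `2 * (g +
  -- g)`.
  have hF (a) (ha : a ∈ S) (x k) : #(F a x k) ≤ 4 * g := by
    have h₁ : #(F a x k) ≤ ∑ z, 2 * ((∑ y, #{q ∈ H a (z, y) | q.1.1 = k}) / (g * g) + 1) := by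
      apply le_trans card_biUnion_le
      rw [Fintype.sum_prod_type]
      gcongr with z _
      simp only [filter_filter]
      exact hcol a ha z k x
    have h₂ : ∑ z, ∑ y, #{q ∈ H a (z, y) | q.1.1 = k} ≤ g * (g * g) := by
      rw [← Fintype.sum_prod_type (f := fun i => #{q ∈ H a i | q.1.1 = k})]
      calc
        _ ≤ ∑ i, ∑ l, #{q ∈ H a i | q.1 = (k, l)} := sum_le_sum fun i _ => by
          rw [card_eq_sum_card_fiberwise (f := fun q => q.1.2) (t := univ) (by simp)]
          simp only [filter_filter, Prod.ext_iff, le_refl]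
        _ ≤ _ := by
          rw [sum_comm]
          simpa using sum_le_sum fun l (_ : l ∈ univ) => hin a ha (k, l)
    have h₃ : ∑ z, (∑ y, #{q ∈ H a (z, y) | q.1.1 = k}) / (g * g) ≤ g := by
      have h₄ : (∑ z, (∑ y, #{q ∈ H a (z, y) | q.1.1 = k}) / (g * g)) * (g * g) ≤ g * (g * g) := by
        rw [sum_mul]
        exact (sum_le_sum fun z _ => Nat.div_mul_le_self _ _).trans h₂
      exact Nat.le_of_mul_le_mul_right h₄ hgg
    rw [← mul_sum, sum_add_distrib] at h₁
    simp only [sum_const, card_univ, Fintype.card_fin, smul_eq_mul, mul_one] at h₁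
    omega
  -- The relay divides its at most `4 * g` packets for a row among the `g` members of that row. The
  -- colouring lemma with trivial keys gives at most `8` for each, as `2 * (4 * g) ≤ 8 * g`.
  have hspl (E : Finset ((Fin g × Fin g) × α)) :
      ∃ f : (Fin g × Fin g) × α → Fin g, #E ≤ 4 * g → ∀ y, #{q ∈ E | f q = y} ≤ 8 := by
    by_cases hE : #E ≤ 4 * g
    · obtain ⟨f, hf⟩ := exists_balanced_coloring (X := Fin g) E (fun _ => ()) (fun _ => ())
        (fun _ => 8) (fun _ => 8) (by simp; omega) (by simp; omega)
      exact ⟨f, fun _ y => by simpa using (hf y).1 ()⟩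
    · exact ⟨fun _ => 0, fun h => (hE h).elim⟩
  choose spl hspl using hspl
  let E (a : I) (x u : Fin g × Fin g) : Finset ((Fin g × Fin g) × α) :=
    {q ∈ F a x u.1 | spl (F a x u.1) q = u.2}
  have hE (a) (ha : a ∈ S) (x u) : #(E a x u) ≤ 8 := hspl _ (hF a ha x u.1) u.2
  have hdE : Det S (V.adjoin fun a x i => {q ∈ H a i | col a i q = x}) E :=
    (det_adjoin _).comp fun x (T : Fin g × Fin g → Finset ((Fin g × Fin g) × α))
      (u : Fin g × Fin g) =>
        {q ∈ univ.biUnion fun i => {q ∈ T i | q.1.1 = u.1} |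
          spl (univ.biUnion fun i => {q ∈ T i | q.1.1 = u.1}) q = u.2}
  let H' (a : I) (u : Fin g × Fin g) : Finset ((Fin g × Fin g) × α) :=
    univ.biUnion fun x => E a x u
  have hlE := learn_finset hdE (k := 16) (fun a ha x u => (hE a ha x u).trans (by simp)) hB'
  have hdH' := (det_adjoin (S := S) (V := V) fun a u x => E a x u).comp fun _ y => univ.biUnion y
  have hl₂ : Learn B S 4 V H' := (hl₁.trans hlE).of_det hdH'
  have memH' (a u q) : q ∈ H' a u ↔ ∃ x, q.1.1 = u.1 ∧ spl (F a x u.1) q = u.2 ∧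
      ∃ i, q ∈ H a i ∧ col a i q = x := by
    simp only [H', E, F, mem_biUnion, mem_filter, mem_univ, true_and]
    exact ⟨fun ⟨x, ⟨i, h, hu⟩, hs⟩ => ⟨x, hu, hs, i, h⟩, fun ⟨x, hu, hs, i, h⟩ => ⟨x, ⟨i, h, hu⟩, hs⟩⟩
  -- Moving packets into their destination row creates no copies: each packet of a source has one
  -- relay, and each relay picks one member of the row. So the load of a destination does not grow.
  have hcount (a) (ha : a ∈ S) (k l) : ∑ y, #{q ∈ H' a (k, y) | q.1.2 = l} ≤ g * g := by
    calc
      _ ≤ ∑ y, ∑ x, #{q ∈ E a x (k, y) | q.1.2 = l} := sum_le_sum fun y _ => by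
        simp only [H', filter_biUnion]
        exact card_biUnion_le
      _ = ∑ x, #{q ∈ F a x k | q.1.2 = l} := by
        rw [sum_comm]
        apply sum_congr rfl; intro x _
        rw [card_eq_sum_card_fiberwise (f := spl (F a x k)) (t := univ) (by simp)]
        simp only [E, filter_filter, and_comm]
      _ ≤ ∑ x, ∑ i, #{q ∈ {q ∈ H a i | q.1 = (k, l)} | col a i q = x} := sum_le_sum fun x _ => by
        simp only [F, filter_biUnion]
        apply card_biUnion_le.trans
        apply sum_le_sum
        rintro i -
        apply card_le_card
        intro q
        simp only [mem_filter, Prod.ext_iff]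
        exact fun ⟨⟨⟨h, hc⟩, hk⟩, hl⟩ => ⟨⟨h, hk, hl⟩, hc⟩
      _ = ∑ i, #{q ∈ H a i | q.1 = (k, l)} := by
        rw [sum_comm]
        exact sum_congr rfl fun i _ => (card_eq_sum_card_fiberwise (by simp)).symm
      _ ≤ _ := hin a ha (k, l)
  have hH' (a) (ha : a ∈ S) (u) : #(H' a u) ≤ 8 * (g * g) := by
    calc
      #(H' a u) ≤ ∑ x, #(E a x u) := card_biUnion_le
      _ ≤ ∑ _x : Fin g × Fin g, 8 := sum_le_sum fun x _ => hE a ha x u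
      _ = 8 * (g * g) := by simp [mul_comm]
  -- Second phase: the packets are in the correct row and the key is the column. Each relay gets at
  -- most `2 * (1 + 1)` packets from a row for each destination and can deliver them directly. The
  -- exponent `16` in `hB'` is `2 * C` for `C = 8`.
  obtain ⟨col', hl₃, hcol'⟩ := exists_learn_relay (C := 8) (B := B) (V := V.adjoin H')
    (fun q => q.1.2) (det_adjoin _) hH' hB hB'
  let G (a : I) (x u : Fin g × Fin g) : Finset ((Fin g × Fin g) × α) :=
    univ.biUnion fun y => {q ∈ {q ∈ H' a (u.1, y) | col' a (u.1, y) q = x} | q.1.2 = u.2}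
  have hG (a) (ha : a ∈ S) (x u) : #(G a x u) ≤ 16 := by
    have h₁ : #(G a x u) ≤ _ := card_biUnion_le
    simp only [filter_filter] at h₁
    have h₂ := Nat.div_le_div_right (c := g * g) (hcount a ha u.1 u.2)
    rw [Nat.div_self hgg] at h₂
    have := hcol' a ha u.1 u.2 x
    omega
  have hdG := (det_adjoin (S := S) (V := V.adjoin H')
    fun a x i => {q ∈ H' a i | col' a i q = x}).comp fun x T (u : Fin g × Fin g) =>
      univ.biUnion fun y => {q ∈ T (u.1, y) | q.1.2 = u.2}
  have hl₄ : Learn B S 4 (V.adjoin H') fun a u x => G a x u := hl₃.trans (learn_finset hdG hG hB')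
  have hl₅ : Learn B S 8 V fun a u x => G a x u := hl₂.trans hl₄
  have he : (fun (a : I) (u : Fin g × Fin g) => {x : α | ∃ i, (u, x) ∈ H a i}) =
      fun a u => {z : α | ∃ x, (u, z) ∈ G a x u} := by
    ext a u z
    simp only [G, Set.mem_ofPred_eq, mem_biUnion, mem_filter, mem_univ, true_and, memH']
    exact ⟨fun ⟨i, hi⟩ => ⟨_, _, ⟨⟨_, rfl, i, hi, rfl⟩, rfl⟩, trivial⟩,
      fun ⟨_, _, ⟨⟨_, _, i, hi, _⟩, _⟩, _⟩ => ⟨i, hi⟩⟩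
  rw [he]
  exact hl₅.received

end View

/-! ### Hosting grid nodes on clique nodes -/

namespace View

variable {I κ ν : Type} [DecidableEq ν]

/-- The view of nodes `ν` that play the nodes `κ`: each of them knows what its guests know. -/
def hosted (host : κ → ν) (V : View I κ) : View I ν :=
  ⟨κ → Option V.Z, fun a v i => if host i = v then some (V.val a i) else none⟩

/-- Two clique nodes host at most `Q` grid nodes each, so at most `Q * Q` virtual messages pass from
one to the other, and all of them together are encoded injectively in one message. -/
theorem Round.hosted [Fintype κ] {host : κ → ν} {Q B b : ℕ} {S : Set I} {V W : View I κ}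
    (h : Round B S V W) (hQ : ∀ v, Fintype.card {i // host i = v} ≤ Q) (hb : B ^ (Q * Q) ≤ 2 ^ b) :
    ∃ (send : ν → (V.hosted host).Z → ν → BitVec b)
      (recv : ν → (V.hosted host).Z → (ν → BitVec b) → (W.hosted host).Z),
      ∀ a ∈ S, ∀ v, (W.hosted host).val a v =
        recv v ((V.hosted host).val a v) fun u => send u ((V.hosted host).val a u) v := by
  classical
  obtain ⟨M, _, _, hM, send, recv, hr⟩ := h
  have henc (u v : ν) : ∃ enc : ({i // host i = u} → {i // host i = v} → M) → BitVec b,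
      Function.Injective enc := by
    have hc : Fintype.card ({i // host i = u} → {i // host i = v} → M) ≤
        Fintype.card (Fin (2 ^ b)) := by
      have hM₀ : 0 < Fintype.card M := Fintype.card_pos
      rw [Fintype.card_fun, Fintype.card_fun, Fintype.card_fin, ← pow_mul]
      calc
        _ ≤ Fintype.card M ^ (Q * Q) := Nat.pow_le_pow_right hM₀ (Nat.mul_le_mul (hQ v) (hQ u))
        _ ≤ _ := (Nat.pow_le_pow_left hM _).trans hb
    obtain ⟨e⟩ := Function.Embedding.nonempty_of_card_le hc
    exact ⟨fun x => BitVec.ofFin (e x), fun x y hxy => e.injective (by simpa using hxy)⟩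
  choose enc henc using henc
  refine ⟨fun u z v => enc u v fun i j => (z i).elim (Classical.arbitrary M) fun x => send i x j,
    fun v z inbox j => if h : host j = v then (z j).map fun x => recv j x fun i =>
      Function.invFun (enc (host i) v) (inbox (host i)) ⟨i, rfl⟩ ⟨j, h⟩ else none, ?_⟩
  intro a ha v
  funext j
  by_cases hj : host j = v
  · simp [View.hosted, hj, hr a ha, Function.leftInverse_invFun (henc _ _) _]
  · simp [View.hosted, hj]

/-- An infinite sequence of rounds yields a congested clique algorithm. -/
theorem exists_clique_run {n b B Q : ℕ} [Fintype κ] {Ω : Fin n → Type} {host : κ → Fin n}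
    (hQ : ∀ v, Fintype.card {i // host i = v} ≤ Q) (hb : B ^ (Q * Q) ≤ 2 ^ b)
    (graph : I → SimpleGraph (Fin n)) (tape : I → ∀ v, Ω v) {c : ℕ → View I κ} {S : ℕ → Set I}
    (hc : ∀ j, Round B (S j) (c j) (c (j + 1)))
    (init : (v : Fin n) → Ω v → Set (Fin n) → ((c 0).hosted host).Z)
    (hinit : ∀ a v, ((c 0).hosted host).val a v = init v (tape a v) ((graph a).neighborSet v)) :
    ∃ (A : CongestedClique n b Ω) (out : A.State → Σ j, ((c j).hosted host).Z),
      ∀ a j, (∀ i < j, a ∈ S i) → ∀ v,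
        out (A.run (graph a) (tape a) j v) = ⟨j, ((c j).hosted host).val a v⟩ := by
  choose send recv hr using fun j => (hc j).hosted hQ hb
  -- The state carries the round number, since the type of the view and the functions `send` and
  -- `recv` change from round to round.
  let A : CongestedClique n b Ω :=
    { State := Σ j, ((c j).hosted host).Z
      init := fun v ω E => ⟨0, init v ω E⟩
      send := fun v x u => send x.1 v x.2 u
      recv := fun v x inbox => ⟨x.1 + 1, recv x.1 v x.2 inbox⟩ }
  refine ⟨A, id, fun a j => ?_⟩
  induction j with
  | zero => exact fun _ v => by simp [CongestedClique.run, A, hinit]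
  | succ j ih =>
    intro hj v
    have ih' (u) : A.run (graph a) (tape a) j u = ⟨j, ((c j).hosted host).val a u⟩ :=
      ih (fun i hi => hj i (by omega)) u
    simp only [CongestedClique.run, ih', id]
    simp only [A, hr j a (hj j (by omega)) v]

/-- If the views `V t` can be reached one after the other in `K` rounds each, then a congested
clique algorithm computes all of them. -/
theorem exists_clique_of_reach {n b B Q K : ℕ} [Fintype κ] {Ω : Fin n → Type} {host : κ → Fin n}
    (hQ : ∀ v, Fintype.card {i // host i = v} ≤ Q) (hb : B ^ (Q * Q) ≤ 2 ^ b) (hK : 0 < K)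
    (graph : I → SimpleGraph (Fin n)) (tape : I → ∀ v, Ω v) {V : ℕ → View I κ} {S : ℕ → Set I}
    (hS : Antitone S) (hV : ∀ t, Reach B (S t) K (V t) (V (t + 1)))
    (init : (v : Fin n) → Ω v → Set (Fin n) → ((V 0).hosted host).Z)
    (hinit : ∀ a v, ((V 0).hosted host).val a v = init v (tape a v) ((graph a).neighborSet v)) :
    ∃ (A : CongestedClique n b Ω) (out : A.State → Σ t, ((V t).hosted host).Z),
      ∀ t, ∀ a ∈ S t, ∀ v,
        out (A.run (graph a) (tape a) (K * (t + 1)) v) =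
          ⟨t + 1, ((V (t + 1)).hosted host).val a v⟩ := by
  obtain ⟨c, hcV, hc⟩ := exists_infinite_chain hK hV
  have hc₀ : c 0 = V 0 := hcV 0
  obtain ⟨init', hinit'⟩ : ∃ init' : (v : Fin n) → Ω v → Set (Fin n) → ((c 0).hosted host).Z,
      ∀ a v, ((c 0).hosted host).val a v = init' v (tape a v) ((graph a).neighborSet v) := by
    rw [hc₀]
    exact ⟨init, hinit⟩
  obtain ⟨A, out, hA⟩ := exists_clique_run hQ hb graph tape hc init' hinit'
  -- The equation `c (K * t) = V t` is an equality of views with different state types; `f`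
  -- transports along it. The value at other times is irrelevant.
  have hcast (j) : ∃ f : ((c j).hosted host).Z → Σ t, ((V t).hosted host).Z, ∀ t, K * t = j →
      ∀ a v, f (((c j).hosted host).val a v) = ⟨t, ((V t).hosted host).val a v⟩ := by
    by_cases hj : ∃ t, K * t = j
    · obtain ⟨t, rfl⟩ := hj
      rw [hcV]
      refine ⟨fun z => ⟨t, z⟩, fun t' ht a v => ?_⟩
      rw [Nat.eq_of_mul_eq_mul_left hK ht]
    · exact ⟨fun _ => ⟨0, fun _ => none⟩, fun t ht => (hj ⟨t, ht⟩).elim⟩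
  choose f hf using hcast
  refine ⟨A, fun x => f (out x).1 (out x).2, fun t a ha v => ?_⟩
  have h := hA a (K * (t + 1))
    (fun i hi => hS (Nat.lt_succ_iff.1 (Nat.div_lt_of_lt_mul hi)) ha) v
  dsimp only
  rw [h]
  exact hf _ _ rfl a v

end View

/-! ### A global enumeration of the edges that their owners can compute -/

section

open Finset

/-- The neighbours of `v` in `E` that are larger than `v`; the edges to these are owned by `v`. -/
noncomputable def ownedNeighbors {n : ℕ} (v : Fin n) (E : Set (Fin n)) : Finset (Fin n) :=
  open Classical in {u | v < u ∧ u ∈ E}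

theorem mem_ownedNeighbors {n : ℕ} {v u : Fin n} {E : Set (Fin n)} :
    u ∈ ownedNeighbors v E ↔ v < u ∧ u ∈ E := by
  simp [ownedNeighbors]

/-- The rank of the edge from `v` to `u`, where `cnt` are the numbers of edges owned by the nodes
and `E` is the set of neighbours of `v`. -/
noncomputable def edgeRank {n : ℕ} (cnt : Fin n → ℕ) (v : Fin n) (E : Set (Fin n)) (u : Fin n) : ℕ :=
  ∑ v' with v' < v, cnt v' + (exists_bijOn_Iio_card (ownedNeighbors v E)).choose u

/-- The pairs `(v, u)` with `v < u` that form the edges of `G`. -/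
noncomputable def orientedEdges {n : ℕ} (G : SimpleGraph (Fin n)) : Finset (Fin n × Fin n) :=
  open Classical in {e | e.1 < e.2 ∧ G.Adj e.1 e.2}

noncomputable def ownedCount {n : ℕ} (G : SimpleGraph (Fin n)) (v : Fin n) : ℕ :=
  #(ownedNeighbors v (G.neighborSet v))

/-- The rank of an oriented edge in an enumeration of all edges of `G`. -/
noncomputable def orientedRank {n : ℕ} (G : SimpleGraph (Fin n)) (e : Fin n × Fin n) : ℕ :=
  edgeRank (ownedCount G) e.1 (G.neighborSet e.1) e.2

section

variable {n : ℕ} {G : SimpleGraph (Fin n)}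

theorem mem_orientedEdges {e : Fin n × Fin n} :
    e ∈ orientedEdges G ↔ e.1 < e.2 ∧ G.Adj e.1 e.2 := by
  simp [orientedEdges]

theorem mem_ownedNeighbors_of_mem {e : Fin n × Fin n} (he : e ∈ orientedEdges G) :
    e.2 ∈ ownedNeighbors e.1 (G.neighborSet e.1) :=
  mem_ownedNeighbors.2 (mem_orientedEdges.1 he)

/-- The ranks of the edges owned by `e.1` start at the number of edges with smaller owners. The
owners thus occupy consecutive intervals, which makes the ranks distinct. -/
theorem orientedRank_lt {e : Fin n × Fin n} (he : e ∈ orientedEdges G) :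
    orientedRank G e < ∑ v with v < e.1, ownedCount G v + ownedCount G e.1 := by
  unfold orientedRank edgeRank
  gcongr
  exact (exists_bijOn_Iio_card _).choose_spec.mapsTo (mem_ownedNeighbors_of_mem he)

theorem sum_ownedCount_add_le (v : Fin n) :
    ∑ v' with v' < v, ownedCount G v' + ownedCount G v ≤ ∑ v', ownedCount G v' := by
  rw [add_comm, ← sum_insert (by simp)]
  exact sum_le_sum_of_subset (subset_univ _)

theorem orientedRank_lt_of_fst_lt {e e' : Fin n × Fin n} (he : e ∈ orientedEdges G)
    (h : e.1 < e'.1) : orientedRank G e < orientedRank G e' := by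
  refine (orientedRank_lt he).trans_le (le_trans ?_ (Nat.le_add_right _ _))
  rw [add_comm, ← sum_insert (by simp)]
  refine sum_le_sum_of_subset fun v hv => ?_
  simp only [mem_insert, mem_filter, mem_univ, true_and] at hv ⊢
  rcases hv with rfl | hv
  · exact h
  · exact hv.trans h

theorem injOn_orientedRank : Set.InjOn (orientedRank G) (orientedEdges G) := by
  rintro ⟨v, u⟩ he ⟨v', u'⟩ he' h
  rcases lt_trichotomy v v' with hv | rfl | hv
  · exact absurd h (orientedRank_lt_of_fst_lt he hv).ne
  · have hb := (exists_bijOn_Iio_card (ownedNeighbors v (G.neighborSet v))).choose_spec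
    have hu := mem_ownedNeighbors_of_mem he
    have hu' := mem_ownedNeighbors_of_mem he'
    exact Prod.ext rfl (hb.injOn hu hu' (Nat.add_left_cancel h))
  · exact absurd h (orientedRank_lt_of_fst_lt he' hv).ne'

theorem card_orientedEdges : #(orientedEdges G) = ∑ v, ownedCount G v := by
  rw [card_eq_sum_card_fiberwise (f := Prod.fst) (t := univ) (by simp)]
  refine sum_congr rfl fun v _ => card_bij' (fun e _ => e.2) (fun u _ => (v, u)) ?_ ?_ ?_ ?_
  · rintro ⟨v', u⟩ h
    obtain ⟨he, rfl⟩ := mem_filter.1 h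
    exact mem_ownedNeighbors_of_mem he
  · intro u h
    exact mem_filter.2 ⟨mem_orientedEdges.2 (mem_ownedNeighbors.1 h), rfl⟩
  · rintro ⟨v', u⟩ h
    obtain ⟨h, rfl⟩ := mem_filter.1 h
    rfl
  · intros
    rfl

theorem image_orientedEdges : Function.uncurry Sym2.mk '' (orientedEdges G : Set (Fin n × Fin n)) = G.edgeSet := by
  ext e
  induction e using Sym2.ind with | _ v u => ?_
  simp only [Set.mem_image, mem_coe, mem_orientedEdges, SimpleGraph.mem_edgeSet, Prod.exists,
    Function.uncurry_apply_pair]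
  constructor
  · rintro ⟨v', u', ⟨_, h⟩, he⟩
    rwa [← SimpleGraph.mem_edgeSet, ← he]
  · intro h
    rcases lt_or_gt_of_ne h.ne with hv | hv
    · exact ⟨v, u, ⟨hv, h⟩, rfl⟩
    · exact ⟨u, v, ⟨hv, h.symm⟩, Sym2.eq_swap⟩

theorem injOn_orientedEdges :
    Set.InjOn (Function.uncurry Sym2.mk) (orientedEdges G : Set (Fin n × Fin n)) := by
  rintro ⟨v, u⟩ h ⟨v', u'⟩ h' he
  have h₁ := (mem_orientedEdges.1 h).1
  have h₂ := (mem_orientedEdges.1 h').1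
  rcases Sym2.eq_iff.1 he with ⟨rfl, rfl⟩ | ⟨rfl, rfl⟩
  · rfl
  · exact absurd h₁ h₂.asymm

theorem ncard_edgeSet : G.edgeSet.ncard = ∑ v, ownedCount G v := by
  rw [← image_orientedEdges, injOn_orientedEdges.ncard_image, Set.ncard_coe_finset,
    card_orientedEdges]

/-- The edges with rank in the `i`-th interval of length `h`. -/
noncomputable def edgeBlock (G : SimpleGraph (Fin n)) (h i : ℕ) : Finset (Fin n × Fin n) :=
  {e ∈ orientedEdges G | orientedRank G e / h = i}

theorem mem_edgeBlock {h i : ℕ} {e : Fin n × Fin n} :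
    e ∈ edgeBlock G h i ↔ e ∈ orientedEdges G ∧ orientedRank G e / h = i :=
  mem_filter

/-- Division by `h = 0` would put every edge into block `0`, so that case is allowed only without
edges. -/
theorem card_edgeBlock_le {h : ℕ} (hm : 0 < h ∨ orientedEdges G = ∅) (i : ℕ) :
    #(edgeBlock G h i) ≤ h := by
  rcases hm with hm | hm
  · calc
      _ ≤ #(Ico (i * h) (i * h + h)) := card_le_card_of_injOn (orientedRank G) (fun e he => by
          have he := (mem_filter.1 he).2
          have := (Nat.div_eq_iff hm).1 he
          simp only [coe_Ico, Set.mem_Ico]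
          omega) (injOn_orientedRank.mono fun e he => (mem_filter.1 he).1)
      _ = h := by simp
  · simp [edgeBlock, hm]

end

/-! ### The initial distribution by blocks of edges -/

namespace SemiMPC

variable {c n : ℕ} {R : Type} (A : SemiMPC c n R)

/-- The distribution that gives each machine an interval of the enumeration of the edges. -/
noncomputable def blockDistribution (G : SimpleGraph (Fin n)) (i : Fin (A.p G.edgeSet.ncard)) :
    Set (Sym2 (Fin n)) :=
  Function.uncurry Sym2.mk '' (edgeBlock G (A.s / 2) i : Set (Fin n × Fin n))

variable {A} {G : SimpleGraph (Fin n)}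

theorem IsDistribution.ncard_edgeSet_le {D} (hD : A.IsDistribution G D) :
    G.edgeSet.ncard ≤ A.p G.edgeSet.ncard * (A.s / 2) := by
  calc
    _ = (⋃ i, D i).ncard := by rw [hD.union]
    _ ≤ ∑ i, (D i).ncard := by
      simpa using Set.ncard_iUnion_le_of_fintype D
    _ ≤ ∑ _i : Fin (A.p G.edgeSet.ncard), A.s / 2 := sum_le_sum fun i _ => by
      have := hD.fits i
      omega
    _ = _ := by simp

theorem pos_or_orientedEdges_eq_empty (h : G.edgeSet.ncard ≤ A.p G.edgeSet.ncard * (A.s / 2)) :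
    0 < A.s / 2 ∨ orientedEdges G = ∅ := by
  rcases Nat.eq_zero_or_pos (A.s / 2) with h₀ | h₀
  · right
    rw [h₀, mul_zero, ncard_edgeSet, ← card_orientedEdges] at h
    simpa using h
  · exact Or.inl h₀

theorem isDistribution_blockDistribution
    (h : G.edgeSet.ncard ≤ A.p G.edgeSet.ncard * (A.s / 2)) :
    A.IsDistribution G (A.blockDistribution G) where
  disjoint i j hij := by
    refine Set.disjoint_left.2 ?_
    rintro _ ⟨e, he, rfl⟩ ⟨e', he', hee⟩
    rw [mem_coe, edgeBlock, mem_filter] at he he'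
    rw [injOn_orientedEdges he'.1 he.1 hee] at he'
    exact hij (Fin.ext (he.2.symm.trans he'.2))
  union := by
    refine Eq.trans ?_ image_orientedEdges
    ext e
    simp only [Set.mem_iUnion, blockDistribution, Set.mem_image, mem_coe, edgeBlock, mem_filter]
    constructor
    · rintro ⟨i, e, he, rfl⟩
      exact ⟨e, he.1, rfl⟩
    · rintro ⟨e, he, rfl⟩
      refine ⟨⟨orientedRank G e / (A.s / 2), ?_⟩, e, ⟨he, rfl⟩, rfl⟩
      have := (orientedRank_lt he).trans_le (sum_ownedCount_add_le _)
      rw [← ncard_edgeSet] at this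
      exact Nat.div_lt_of_lt_mul (by rw [mul_comm]; exact this.trans_le h)
  fits i := by
    have h₁ : (A.blockDistribution G i).ncard ≤ #(edgeBlock G (A.s / 2) i) := by
      rw [← Set.ncard_coe_finset]
      exact Set.ncard_image_le (Finset.finite_toSet _)
    have := card_edgeBlock_le (pos_or_orientedEdges_eq_empty h) i
    omega

end SemiMPC

/-! ### Indices of grid nodes and recovery of lists -/

/-- The position of a node of the square grid in the lexicographic enumeration. -/
def gridIndex {g : ℕ} (x : Fin g × Fin g) : ℕ := finProdFinEquiv x

/-- The node of the square grid with index `i`. -/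
def gridNode {g m : ℕ} (h : m ≤ g * g) (i : Fin m) : Fin g × Fin g :=
  finProdFinEquiv.symm (i.castLE h)

theorem gridIndex_lt {g : ℕ} (x : Fin g × Fin g) : gridIndex x < g * g := (finProdFinEquiv x).2

theorem gridIndex_injective {g : ℕ} : Function.Injective (gridIndex (g := g)) := fun _ _ h =>
  finProdFinEquiv.injective (Fin.ext h)

@[simp] theorem gridIndex_gridNode {g m : ℕ} (h : m ≤ g * g) (i : Fin m) :
    gridIndex (gridNode h i) = i := by
  rw [gridIndex, gridNode, Equiv.apply_symm_apply, Fin.val_castLE]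

theorem sum_gridIndex {g m : ℕ} (h : m ≤ g * g) (F : ℕ → ℕ) (hF : ∀ i, m ≤ i → F i = 0) :
    ∑ x : Fin g × Fin g, F (gridIndex x) = ∑ i : Fin m, F i := by
  refine (Fintype.sum_of_injective (gridNode h) (fun i j hij => ?_) _ _ (fun x hx => ?_)
    fun i => ?_).symm
  · have := congrArg gridIndex hij
    simp only [gridIndex_gridNode] at this
    exact Fin.ext this
  · refine hF _ (not_lt.1 fun hlt => hx ⟨⟨gridIndex x, hlt⟩, gridIndex_injective ?_⟩)
    simp
  · simp

/-- A list of length at most `s` is determined by its entries and their positions. -/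
theorem exists_list_of_entries (s : ℕ) (β : Type*) :
    ∃ dec : Set (Fin s × β) → List β, ∀ l : List β, l.length ≤ s →
      dec {e | l[e.1]? = some e.2} = l := by
  have : Set.InjOn (fun l : List β => {e : Fin s × β | l[e.1]? = some e.2})
      {l | l.length ≤ s} := by
    intro l hl l' hl' h
    refine List.ext_getElem? fun i => ?_
    rcases lt_or_ge i s with hi | hi
    · refine Option.ext fun x => ?_
      simpa using Set.ext_iff.1 h (⟨i, hi⟩, x)
    · rw [List.getElem?_eq_none (le_trans hl hi), List.getElem?_eq_none (le_trans hl' hi)]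
  exact ⟨Function.invFunOn _ _, fun l hl => this.leftInvOn_invFunOn hl⟩

/-! ### Simulating one round of the machines on the grid -/

namespace SemiMPC

open View

variable {c n : ℕ} {R : Type} (A : SemiMPC c n R)

/-- The memory of machine `i` (if there is such a machine) after `t` rounds, started from
`blockDistribution`. -/
noncomputable def memory (G : SimpleGraph (Fin n)) (r : ℕ → R) (t i : ℕ) : Fin A.s → BitVec A.w :=
  if h : i < A.p G.edgeSet.ncard then
    A.run G.edgeSet.ncard (A.blockDistribution G) r t ⟨i, h⟩ else fun _ => 0

/-- The initial memory of machine `i` (if there is such a machine) with the oriented edges `E`. -/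
def initMemory (m i : ℕ) (ρ : R) (E : Set (Fin n × Fin n)) : Fin A.s → BitVec A.w :=
  if h : i < A.p m then A.init m ⟨i, h⟩ ρ (Function.uncurry Sym2.mk '' E) else fun _ => 0

/-- What the machines know after `t` rounds, where machine `i` is played by the `i`-th node of the
grid. -/
noncomputable def machineView (g t : ℕ) : View (SimpleGraph (Fin n) × (ℕ → R)) (Fin g × Fin g) :=
  ⟨ℕ × R × (Fin A.s → BitVec A.w), fun a x =>
    (a.1.edgeSet.ncard, a.2 (gridIndex x), A.memory a.1 a.2 t (gridIndex x))⟩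

/-- What the nodes of the grid know at the beginning. -/
noncomputable def inputView (n : ℕ) (R : Type) (g : ℕ) :
    View (SimpleGraph (Fin n) × (ℕ → R)) (Fin g × Fin g) :=
  ⟨R × Set (Fin n), fun a x =>
    (a.2 (gridIndex x), if h : gridIndex x < n then a.1.neighborSet ⟨gridIndex x, h⟩ else ∅)⟩

/-- The words that machine `i` sends to machine `j`. -/
def outWords (t m i : ℕ) (ρ : R) (mem : Fin A.s → BitVec A.w) (j : ℕ) : List (BitVec A.w) :=
  if h : i < A.p m ∧ j < A.p m then A.send m ⟨i, h.1⟩ ρ t mem ⟨j, h.2⟩ else []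

/-- The words that a node of the grid sends, with destination, source, and position. -/
def packets {g : ℕ} (t : ℕ) (x : Fin g × Fin g) (z : ℕ × R × (Fin A.s → BitVec A.w)) :
    Finset ((Fin g × Fin g) × ((Fin g × Fin g) × Fin A.s × BitVec A.w)) :=
  {q | q.2.1 = x ∧
    (A.outWords t z.1 (gridIndex x) z.2.1 z.2.2 (gridIndex q.1))[q.2.2.1]? = some q.2.2.2}

variable {A}

/-- For fixed source and destination, a packet is determined by its position in the list of words.
Source and position are part of the packet so that equal words stay distinct. -/
theorem card_packets_le {g t : ℕ} (x u : Fin g × Fin g) (z : ℕ × R × (Fin A.s → BitVec A.w)) :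
    #{q ∈ A.packets t x z | q.1 = u} ≤
      (A.outWords t z.1 (gridIndex x) z.2.1 z.2.2 (gridIndex u)).length := by
  rw [← card_range (List.length _)]
  refine card_le_card_of_injOn (fun q => (q.2.2.1 : ℕ)) ?_ ?_
  · rintro ⟨u', x', k, b⟩ hq
    simp only [packets, coe_filter, mem_filter, mem_univ, true_and, Set.mem_ofPred_eq] at hq
    obtain ⟨⟨rfl, h⟩, rfl⟩ := hq
    simp only [coe_range, Set.mem_Iio]
    exact (List.getElem?_eq_some_iff.1 h).1
  · rintro ⟨u', x', k, b⟩ hq ⟨u'', x'', k', b'⟩ hq' hk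
    simp only [packets, coe_filter, mem_filter, mem_univ, true_and, Set.mem_ofPred_eq] at hq hq' hk
    obtain ⟨⟨rfl, h⟩, rfl⟩ := hq
    obtain ⟨⟨rfl, h'⟩, rfl⟩ := hq'
    obtain rfl := Fin.ext hk
    rw [h] at h'
    rw [Option.some.inj h']

theorem outWords_memory (G : SimpleGraph (Fin n)) (r : ℕ → R) (t : ℕ)
    (i j : Fin (A.p G.edgeSet.ncard)) :
    A.outWords t G.edgeSet.ncard i (r i) (A.memory G r t i) j =
      A.send G.edgeSet.ncard i (r i) t
        (A.run G.edgeSet.ncard (A.blockDistribution G) r t i) j := by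
  simp [outWords, memory]

theorem exists_mem_packets_iff {g : ℕ} (G : SimpleGraph (Fin n))
    (hp : A.p G.edgeSet.ncard ≤ g * g) (r : ℕ → R) (t : ℕ) (j : Fin (A.p G.edgeSet.ncard))
    (y : Fin g × Fin g) (e : Fin A.s × BitVec A.w) :
    (∃ x, (y, gridNode hp j, e) ∈
        A.packets t x (G.edgeSet.ncard, r (gridIndex x), A.memory G r t (gridIndex x))) ↔
      (A.outWords t G.edgeSet.ncard j (r j) (A.memory G r t j) (gridIndex y))[e.1]? = some e.2 := by
  simp [packets]

theorem length_outWords (G : SimpleGraph (Fin n)) (r : ℕ → R) (t : ℕ)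
    (i j : Fin (A.p G.edgeSet.ncard)) :
    (A.outWords t G.edgeSet.ncard i (r i) (A.memory G r t i) j).length =
      A.traffic G.edgeSet.ncard (A.blockDistribution G) r t i j := by
  rw [outWords_memory, traffic]

theorem outWords_eq_nil {t m i j : ℕ} {ρ : R} {mem : Fin A.s → BitVec A.w}
    (h : A.p m ≤ i ∨ A.p m ≤ j) : A.outWords t m i ρ mem j = [] := by
  rw [outWords, dif_neg (by omega)]

/-- The inputs on which the algorithm runs for more than `t` rounds. -/
def runsAfter (A : SemiMPC c n R) (t : ℕ) : Set (SimpleGraph (Fin n) × (ℕ → R)) :=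
  {a | A.RunsFor a.1 (t + 1)}

theorem antitone_runsAfter : Antitone A.runsAfter := fun _ _ h _ ha =>
  ⟨ha.fits, fun D hD r t ht => ha.send_le D hD r t (by omega),
    fun D hD r t ht => ha.recv_le D hD r t (by omega)⟩

theorem isDistribution_of_exists {G : SimpleGraph (Fin n)} (h : ∃ D, A.IsDistribution G D) :
    A.IsDistribution G (A.blockDistribution G) := by
  obtain ⟨D, hD⟩ := h
  exact isDistribution_blockDistribution hD.ncard_edgeSet_le

theorem sum_outWords_send {g t : ℕ} (hs : A.s ≤ g * g) {a : SimpleGraph (Fin n) × (ℕ → R)}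
    (ha : a ∈ A.runsAfter t) (x : Fin g × Fin g) :
    ∑ u : Fin g × Fin g, (A.outWords t a.1.edgeSet.ncard (gridIndex x) (a.2 (gridIndex x))
      (A.memory a.1 a.2 t (gridIndex x)) (gridIndex u)).length ≤ A.s := by
  rcases lt_or_ge (gridIndex x) (A.p a.1.edgeSet.ncard) with hx | hx
  · rw [sum_gridIndex ((A.p_le _).trans hs) (fun u => (A.outWords t a.1.edgeSet.ncard (gridIndex x)
      (a.2 (gridIndex x)) (A.memory a.1 a.2 t (gridIndex x)) u).length)
      fun i hi => by rw [outWords_eq_nil (Or.inr hi), List.length_nil]]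
    refine le_trans (le_of_eq (sum_congr rfl fun j _ => ?_)) (ha.send_le _
      (isDistribution_of_exists ha.fits) a.2 t (Nat.lt_succ_self t) ⟨_, hx⟩)
    exact length_outWords a.1 a.2 t ⟨_, hx⟩ j
  · simp [outWords_eq_nil (Or.inl hx)]

theorem sum_outWords_recv {g t : ℕ} (hs : A.s ≤ g * g) {a : SimpleGraph (Fin n) × (ℕ → R)}
    (ha : a ∈ A.runsAfter t) (u : Fin g × Fin g) :
    ∑ x : Fin g × Fin g, (A.outWords t a.1.edgeSet.ncard (gridIndex x) (a.2 (gridIndex x))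
      (A.memory a.1 a.2 t (gridIndex x)) (gridIndex u)).length ≤ A.s := by
  rcases lt_or_ge (gridIndex u) (A.p a.1.edgeSet.ncard) with hu | hu
  · rw [sum_gridIndex ((A.p_le _).trans hs) (fun x => (A.outWords t a.1.edgeSet.ncard x
      (a.2 x) (A.memory a.1 a.2 t x) (gridIndex u)).length)
      fun i hi => by rw [outWords_eq_nil (Or.inl hi), List.length_nil]]
    refine le_trans (le_of_eq (sum_congr rfl fun i _ => ?_)) (ha.recv_le _
      (isDistribution_of_exists ha.fits) a.2 t (Nat.lt_succ_self t) ⟨_, hu⟩)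
    exact length_outWords a.1 a.2 t i ⟨_, hu⟩
  · simp [outWords_eq_nil (Or.inr hu)]

/-- One round of the semi-MPC algorithm takes eight rounds. -/
theorem reach_machineView_succ {g B : ℕ} [NeZero g] (t : ℕ) (hs : A.s ≤ g * g)
    (hB : 8 * (g * g) + 1 ≤ B)
    (hB' : (Fintype.card ((Fin g × Fin g) × ((Fin g × Fin g) × Fin A.s × BitVec A.w)) + 1) ^ 16 ≤
      B) :
    Reach B (A.runsAfter t) 8 (A.machineView g t) (A.machineView g (t + 1)) := by
  have hd : Det (A.runsAfter t) (A.machineView g t)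
      fun a x => A.packets t x ((A.machineView g t).val a x) := ⟨fun x z => A.packets t x z,
    fun _ _ _ => rfl⟩
  have hl := learn_route (B := B) hd (fun a ha x => by
      rw [card_eq_sum_card_fiberwise (f := Prod.fst) (t := univ) (by simp)]
      exact ((sum_le_sum fun u _ => card_packets_le x u _).trans
        (sum_outWords_send hs ha x)).trans hs)
    (fun a ha u => ((sum_le_sum fun x _ => card_packets_le x u _).trans
        (sum_outWords_recv hs ha u)).trans hs) hB hB'
  obtain ⟨dec, hdec⟩ := exists_list_of_entries A.s (BitVec A.w)
  refine Reach.map hl ⟨fun y z => (z.1.1, z.1.2.1, if h : gridIndex y < A.p z.1.1 then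
    A.recv z.1.1 ⟨_, h⟩ z.1.2.1 t z.1.2.2 fun j =>
      dec {e | (gridNode ((A.p_le _).trans hs) j, e) ∈ z.2} else fun _ => 0), fun a ha y => ?_⟩
  simp only [machineView, adjoin, memory, Prod.mk.injEq, true_and]
  split_ifs with h
  · simp only [run]
    congr 1
    funext j
    symm
    -- A single list is no longer than all that machine `j` sends, so `dec` recovers it from its
    -- entries.
    have hlen : (A.send a.1.edgeSet.ncard j (a.2 j) t
        (A.run a.1.edgeSet.ncard (A.blockDistribution a.1) a.2 t j) ⟨gridIndex y, h⟩).length ≤ A.s :=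
      le_trans (single_le_sum (f := fun i => A.traffic a.1.edgeSet.ncard (A.blockDistribution a.1)
        a.2 t j i) (fun _ _ => Nat.zero_le _) 
        (mem_univ (⟨gridIndex y, h⟩ : Fin (A.p a.1.edgeSet.ncard)))) (ha.send_le _
        (isDistribution_of_exists ha.fits) a.2 t (Nat.lt_succ_self t) j)
    rw [← hdec _ hlen]
    congr 1
    ext e
    refine (exists_mem_packets_iff a.1 _ a.2 t j y e).trans ?_
    rw [← outWords_memory a.1 a.2 t j ⟨gridIndex y, h⟩]
    rfl
  · rfl

/-! ### Delivering the edges to the machines -/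

/-- The oriented edges that a node of the grid has to send, with their destinations. -/
noncomputable def edgePackets {g : ℕ} (G : SimpleGraph (Fin n)) (h : ℕ) (x : Fin g × Fin g) :
    Finset ((Fin g × Fin g) × (Fin n × Fin n)) :=
  {q | gridIndex x = q.2.1 ∧ q.2 ∈ edgeBlock G h (gridIndex q.1)}

/-- `edgePackets` in terms of the set `E` of neighbours of the node and the numbers of edges owned
by the nodes. -/
noncomputable def localEdgePackets {g : ℕ} (cnt : Fin n → ℕ) (E : Set (Fin n)) (h : ℕ)
    (x : Fin g × Fin g) : Finset ((Fin g × Fin g) × (Fin n × Fin n)) :=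
  open Classical in {q | gridIndex x = q.2.1 ∧ (q.2.1 < q.2.2 ∧ q.2.2 ∈ E) ∧
    edgeRank cnt q.2.1 E q.2.2 / h = gridIndex q.1}

theorem edgePackets_eq {g : ℕ} (G : SimpleGraph (Fin n)) (h : ℕ) (x : Fin g × Fin g) :
    edgePackets G h x = localEdgePackets (ownedCount G)
      (if hx : gridIndex x < n then G.neighborSet ⟨gridIndex x, hx⟩ else ∅) h x := by
  ext ⟨y, v, u⟩
  simp only [edgePackets, localEdgePackets, mem_filter, mem_univ, true_and, mem_edgeBlock,
    mem_orientedEdges, orientedRank, and_assoc]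
  refine and_congr_right fun hx => ?_
  simp [hx]

/-- The source is the smaller endpoint and the rank of the edge fixes the destination, so the larger
endpoint determines the packet. -/
theorem card_edgePackets_le {g h : ℕ} (G : SimpleGraph (Fin n)) (x : Fin g × Fin g) :
    #(edgePackets G h x) ≤ n := by
  refine (card_le_card_of_injOn (t := univ) (fun q => q.2.2) (by simp) ?_).trans_eq
    (Finset.card_fin n)
  rintro ⟨y, v, u⟩ hq ⟨y', v', u'⟩ hq' hu
  simp only [edgePackets, edgeBlock, coe_filter, mem_filter, mem_univ, true_and,
    Set.mem_ofPred_eq] at hq hq' hu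
  obtain rfl := hu
  obtain rfl := Fin.ext (hq.1.symm.trans hq'.1)
  obtain rfl := gridIndex_injective (hq.2.2.symm.trans hq'.2.2)
  rfl

theorem sum_card_edgePackets_le {g h : ℕ} (G : SimpleGraph (Fin n)) (u : Fin g × Fin g) :
    ∑ x, #{q ∈ edgePackets G h x | q.1 = u} ≤ #(edgeBlock G h (gridIndex u)) := by
  rw [← card_sigma]
  refine card_le_card_of_injOn (fun q => q.2.2) ?_ ?_
  · rintro ⟨x, y, e⟩ hq
    simp only [edgePackets, coe_sigma, coe_filter, mem_filter, mem_univ, true_and, coe_univ,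
      Set.mem_sigma_iff, Set.mem_univ, Set.mem_ofPred_eq] at hq
    obtain ⟨⟨_, h⟩, rfl⟩ := hq
    exact h
  · rintro ⟨x, y, e⟩ hq ⟨x', y', e'⟩ hq' he
    simp only [edgePackets, coe_sigma, coe_filter, mem_filter, mem_univ, true_and, coe_univ,
      Set.mem_sigma_iff, Set.mem_univ, Set.mem_ofPred_eq] at hq hq' he
    obtain ⟨⟨h, _⟩, rfl⟩ := hq
    obtain ⟨⟨h', _⟩, rfl⟩ := hq'
    obtain rfl := he
    obtain rfl := gridIndex_injective (h.trans h'.symm)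
    rfl

/-- A broadcast in one round. The counts yield the offsets of the ranks and, as their sum, the
number of edges on which the machines may depend. -/
theorem learn_ownedCount {g B : ℕ} {S : Set (SimpleGraph (Fin n) × (ℕ → R))} (hn : n ≤ g * g)
    (hB : n + 1 ≤ B) : Learn B S 1 (inputView n R g) fun a _ => ownedCount a.1 := by
  have hd : Det S (inputView n R g) fun a x (_ : Fin g × Fin g) =>
      if h : gridIndex x < n then Fin.ofNat (n + 1) (ownedCount a.1 ⟨gridIndex x, h⟩) else 0 :=
    ⟨fun x z _ => if h : gridIndex x < n then
      Fin.ofNat (n + 1) #(ownedNeighbors ⟨gridIndex x, h⟩ z.2) else 0, fun a _ x => by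
      funext _
      simp only [inputView, ownedCount]
      split_ifs <;> rfl⟩
  have hl := learn_inbox (by simpa using hB) hd
  have hd' := (det_adjoin (S := S) (V := inputView n R g) fun a (_ u : Fin g × Fin g) =>
    if h : gridIndex u < n then Fin.ofNat (n + 1) (ownedCount a.1 ⟨gridIndex u, h⟩) else 0).comp
      fun _ y v => (y (gridNode hn v) : ℕ)
  refine hl.of_det (hd'.congr fun a _ x => ?_)
  funext v
  have : ownedCount a.1 v ≤ n := (card_le_univ _).trans_eq (Fintype.card_fin n)
  simp [Nat.mod_eq_of_lt (Nat.lt_succ_of_le this)]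

/-- The machines are initialized in nine rounds. -/
theorem reach_machineView_zero {g B : ℕ} [NeZero g] (hs : A.s ≤ g * g) (hn : n ≤ g * g)
    (hB : 8 * (g * g) + 1 ≤ B)
    (hB' : (Fintype.card ((Fin g × Fin g) × (Fin n × Fin n)) + 1) ^ 16 ≤ B) :
    Reach B (A.runsAfter 0) 9 (inputView n R g) (A.machineView g 0) := by
  have hd : Det (A.runsAfter 0) ((inputView n R g).adjoin fun a _ => ownedCount a.1)
      fun a x => edgePackets a.1 (A.s / 2) x :=
    ⟨fun x z => localEdgePackets z.2 z.1.2 (A.s / 2) x, fun a _ x => edgePackets_eq _ _ _⟩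
  have hl := learn_route (B := B) hd (fun a ha x => (card_edgePackets_le a.1 x).trans hn)
    (fun a ha u => (sum_card_edgePackets_le a.1 u).trans ((card_edgeBlock_le
      (pos_or_orientedEdges_eq_empty ha.fits.choose_spec.ncard_edgeSet_le) _).trans (by omega)))
    hB hB'
  have hr := Reach.trans (learn_ownedCount hn (by omega)) hl
  refine Reach.map hr ⟨fun y z => (∑ v, z.1.2 v, z.1.1.1,
    A.initMemory (∑ v, z.1.2 v) (gridIndex y) z.1.1.1 z.2), fun a ha y => ?_⟩
  have he : {e | ∃ x, (y, e) ∈ edgePackets a.1 (A.s / 2) x} =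
      (edgeBlock a.1 (A.s / 2) (gridIndex y) : Set (Fin n × Fin n)) := by
    ext e
    simp only [edgePackets, mem_filter, mem_univ, true_and, Set.mem_ofPred_eq, mem_coe]
    exact ⟨fun ⟨_, _, h⟩ => h, fun h => ⟨gridNode hn e.1, by simp, h⟩⟩
  simp only [machineView, adjoin, memory, inputView, he, run, blockDistribution, ← ncard_edgeSet]
  rfl

end SemiMPC

end

/-! ### Choice of the grid and the constants -/

/-- The size of the virtual grid: it has at least `(c + 1) * n` and at most `4 * (c + 1) * n`
nodes. -/
theorem exists_grid (c n : ℕ) [NeZero n] :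
    ∃ g : ℕ, 0 < g ∧ (c + 1) * n ≤ g * g ∧ g * g ≤ 4 * (c + 1) * n := by
  set k := (c + 1) * n with hk
  have hk₀ : 0 < k := Nat.mul_pos (Nat.succ_pos c) (NeZero.pos n)
  have h₁ : k < (k.sqrt + 1) * (k.sqrt + 1) := Nat.lt_succ_sqrt k
  have h₂ : k.sqrt * k.sqrt ≤ k := Nat.sqrt_le k
  have h₃ : 0 < k.sqrt := Nat.sqrt_pos.2 hk₀
  refine ⟨k.sqrt + 1, Nat.succ_pos _, h₁.le, ?_⟩
  rw [mul_assoc, ← hk]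
  nlinarith

/-- Grid nodes with the same host have indices in one residue class modulo `n`, so the quotients by
`n`, which are less than `Q`, tell them apart. -/
theorem card_host_fiber_le {n g Q : ℕ} [NeZero n] (h : g * g ≤ Q * n) (v : Fin n) :
    Fintype.card {x : Fin g × Fin g // cliqueHost n (gridIndex x) = v} ≤ Q := by
  rw [← Fintype.card_fin Q]
  refine Fintype.card_le_of_injective (fun x => ⟨gridIndex x.1 / n, Nat.div_lt_of_lt_mul
    (by rw [mul_comm]; exact (gridIndex_lt _).trans_le h)⟩) ?_
  rintro ⟨x, rfl⟩ ⟨y, hy⟩ hxy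
  have h₁ : gridIndex y % n = gridIndex x % n := congrArg Fin.val hy
  have h₂ : gridIndex x / n = gridIndex y / n := congrArg Fin.val hxy
  have h₃ : gridIndex x = gridIndex y := by
    rw [← Nat.div_add_mod (gridIndex x) n, ← Nat.div_add_mod (gridIndex y) n, h₁, h₂]
  exact Subtype.ext (gridIndex_injective h₃)

theorem cliqueHost_val {n : ℕ} [NeZero n] {i : ℕ} (h : i < n) : cliqueHost n i = ⟨i, h⟩ :=
  Fin.ext (Nat.mod_eq_of_lt h)

open View in
/-- If the messages are large enough, then the clique simulates the algorithm with a grid. -/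
theorem SemiMPC.exists_simulates {c n : ℕ} [NeZero n] {R : Type} (A : SemiMPC c n R)
    {g B Q b : ℕ} [NeZero g] (hg : (c + 1) * n ≤ g * g) (hQ : g * g ≤ Q * n)
    (hB : 8 * (g * g) + 1 ≤ B)
    (hE : (Fintype.card ((Fin g × Fin g) × (Fin n × Fin n)) + 1) ^ 16 ≤ B)
    (hW : (Fintype.card ((Fin g × Fin g) × ((Fin g × Fin g) × Fin A.s × BitVec A.w)) + 1) ^ 16 ≤ B)
    (hb : B ^ (Q * Q) ≤ 2 ^ b) :
    ∃ B : CongestedClique n b (CliqueTape n R), Simulates 17 B A := by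
  -- The summand `1` in `c + 1` makes room for the `n` vertices even if `c = 0`.
  have hn : n ≤ g * g := le_trans (by nlinarith) hg
  have hs : A.s ≤ g * g := A.s_le.trans (le_trans (by nlinarith) hg)
  let V : ℕ → View (SimpleGraph (Fin n) × (ℕ → R)) (Fin g × Fin g) := fun t =>
    match t with
    | 0 => inputView n R g
    | t + 1 => A.machineView g (t + 1)
  -- Initialization and the first round take `9 + 8` rounds. Later rounds idle for nine to keep the
  -- number constant.
  have hV (t) : Reach B (A.runsAfter t) 17 (V t) (V (t + 1)) := by
    have h₁ := A.reach_machineView_succ t hs hB hW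
    cases t with
    | zero => exact (reach_machineView_zero hs hn hB hE).trans h₁
    | succ t => exact (Reach.idle 9 (by omega)).trans h₁
  obtain ⟨C, out, hC⟩ := exists_clique_of_reach (host := fun x => cliqueHost n (gridIndex x))
    (Ω := CliqueTape n R) (fun v => card_host_fiber_le hQ v) hb (by norm_num) (fun a => a.1)
    (fun a _ j => a.2 j.1) antitone_runsAfter hV
    -- A grid node of index less than `n` is hosted by the vertex with that index, and so starts
    -- with its neighbours; the others start with a tape only.
    (fun v ω E x => if h : cliqueHost n (gridIndex x) = v then
      some (ω ⟨_, h⟩, if gridIndex x < n then E else ∅) else none) (fun a v => by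
      funext x
      simp only [hosted, V, inputView]
      split_ifs with h₁ h₂
      · rw [← h₁, cliqueHost_val h₂]
      · rfl
      · rfl)
  -- At time `0` the view is the input rather than the memories, so a dummy is read there; this is
  -- where `1 ≤ T` matters.
  refine ⟨C, fun i st => match out st with
    | ⟨0, _⟩ => fun _ => 0
    | ⟨t + 1, z⟩ => if h : i < g * g then
        (z (gridNode le_rfl ⟨i, h⟩)).elim (fun _ => 0) fun y => y.2.2 else fun _ => 0,
    fun G hG => ⟨A.blockDistribution G, SemiMPC.isDistribution_of_exists hG, fun T hT hr r i => ?_⟩⟩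
  obtain ⟨t, rfl⟩ := Nat.exists_eq_succ_of_ne_zero (Nat.one_le_iff_ne_zero.1 hT)
  have hi : (i : ℕ) < g * g := i.2.trans_le ((A.p_le _).trans hs)
  have h := hC t (G, r) hr (cliqueHost n i)
  dsimp only at h ⊢
  rw [Nat.succ_eq_add_one, h]
  simp [hosted, V, hi, SemiMPC.machineView, SemiMPC.memory]

theorem theorem3p2 (c : ℕ) :
    ∃ K b : ℕ, ∀ (n : ℕ) [NeZero n] (R : Type) (A : SemiMPC c n R),
      ∃ B : CongestedClique n (b * (Nat.log 2 n + 1)) (CliqueTape n R), Simulates K B A := by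
  -- With `L = Nat.log 2 n + 1`, a packet takes at most `2 ^ ((3 * (Q + 1) + c) * L)` values: three
  -- factors of size at most `2 ^ ((Q + 1) * L)` and a word. The `1` in `β` covers the option of no
  -- packet, `16` is the number of packets per message, and `Q * Q` accounts for the bundling.
  set Q := 4 * (c + 1) with hQ
  set β := 16 * (3 * (Q + 1) + c + 1) with hβ
  refine ⟨17, β * (Q * Q), fun n _ R A => ?_⟩
  obtain ⟨g, hg₀, hg₁, hg₂⟩ := exists_grid c n
  have : NeZero g := ⟨hg₀.ne'⟩
  set L := Nat.log 2 n + 1 with hL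
  have hL₁ : 1 ≤ L := Nat.le_add_left 1 _
  have hnL : n ≤ 2 ^ L := (Nat.lt_pow_succ_log_self (by norm_num) n).le
  have hgg : g * g ≤ 2 ^ ((Q + 1) * L) := by
    calc
      g * g ≤ Q * n := hg₂
      _ ≤ 2 ^ Q * 2 ^ L := Nat.mul_le_mul Nat.lt_two_pow_self.le hnL
      _ = 2 ^ (Q + L) := (pow_add _ _ _).symm
      _ ≤ _ := Nat.pow_le_pow_right (by norm_num) (by nlinarith)
  have hn : n ≤ 2 ^ ((Q + 1) * L) := hnL.trans (Nat.pow_le_pow_right (by norm_num) (by nlinarith))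
  have hs : A.s ≤ 2 ^ ((Q + 1) * L) := (A.s_le.trans (le_trans (by nlinarith) hg₁)).trans hgg
  have hw : 2 ^ A.w ≤ 2 ^ (c * L) := Nat.pow_le_pow_right (by norm_num) A.w_le
  have hE : g * g * (n * n) ≤ 2 ^ ((3 * (Q + 1) + c) * L) := by
    calc
      _ ≤ 2 ^ ((Q + 1) * L) * (2 ^ ((Q + 1) * L) * 2 ^ ((Q + 1) * L)) := by gcongr
      _ = 2 ^ (3 * (Q + 1) * L) := by rw [← pow_add, ← pow_add]; ring_nf
      _ ≤ _ := Nat.pow_le_pow_right (by norm_num) (by gcongr; omega)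
  have hW : g * g * (g * g * (A.s * 2 ^ A.w)) ≤ 2 ^ ((3 * (Q + 1) + c) * L) := by
    calc
      _ ≤ 2 ^ ((Q + 1) * L) * (2 ^ ((Q + 1) * L) * (2 ^ ((Q + 1) * L) * 2 ^ (c * L))) := by gcongr
      _ = _ := by rw [← pow_add, ← pow_add, ← pow_add]; ring_nf
  have hpow {k : ℕ} (hk : k ≤ 2 ^ ((3 * (Q + 1) + c) * L)) : (k + 1) ^ 16 ≤ 2 ^ (β * L) := by
    calc
      _ ≤ (2 ^ ((3 * (Q + 1) + c) * L + 1)) ^ 16 := by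
        gcongr
        have := Nat.one_le_two_pow (n := (3 * (Q + 1) + c) * L)
        rw [pow_succ]
        omega
      _ = 2 ^ (((3 * (Q + 1) + c) * L + 1) * 16) := (pow_mul _ _ _).symm
      _ ≤ _ := Nat.pow_le_pow_right (by norm_num) (by rw [hβ]; nlinarith)
  refine A.exists_simulates (B := 2 ^ (β * L)) (Q := Q) hg₁ hg₂ ?_ (hpow (by simpa using hE))
    (hpow ?_) ?_
  · calc
      8 * (g * g) + 1 ≤ 2 ^ 3 * 2 ^ ((Q + 1) * L) + 2 ^ 3 * 2 ^ ((Q + 1) * L) := by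
        gcongr
        · norm_num
        · exact Nat.one_le_iff_ne_zero.2 (by positivity)
      _ = 2 ^ (4 + (Q + 1) * L) := by ring
      _ ≤ _ := Nat.pow_le_pow_right (by norm_num) (by rw [hβ]; nlinarith)
  · simpa [Fintype.card_congr BitVec.equivFin.toEquiv] using hW
  · rw [← pow_mul]
    exact Nat.pow_le_pow_right (by norm_num) (le_of_eq (by ring))
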